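/- Let $D$ be a separable complex Hilbert space and $E_1,E_2$ complex Hilbert spaces. For complex Hilbert spaces $X,Y$, let $H^\infty(\mathbb T,\mathcal B(X,Y))$ be the space of essentially bounded SOT-measurable functions $F:\mathbb T\to\mathcal B(X,Y)$, identified when equal almost everywhere, such that for every $x\in X$ all Fourier coefficients of $F(\cdot)x$ of negative index vanish. Put $\breve F(z)=F(\bar z)$ and $\widetilde F(z)=F(\bar z)^*$. A function $F\in H^\infty(\mathbb T,\mathcal B(X,Y))$ is *inner* if $F^*F=I_X$ a.e., and *two-sided inner* if moreover $FF^*=I_Y$ a.e. An inner function $\Omega$ is a *left* (resp. *right*) *inner divisor* of $F$ if $F=\Omega A$ (resp. $F=A\Omega$) for some $H^\infty$ operator function $A$; it is *nontrivial* if it is not a.e. equal to a constant unitary operator. A left inner divisor $\Delta$ of both $F$ and $G$ is a *left-g.c.d.* of $F$ and $G$ if every common left inner divisor of $F$ and $G$ is a left inner divisor of $\Delta$ (it is unique up to a constant unitary right factor). For $F\in L^\infty(\mathbb T,\mathcal B(X,Y))$ let $H_F:H^2(\mathbb T,X)\to H^2(\mathbb T,Y)$, $H_Ff=J\,P_-(Ff)$,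 be the Hankel operator, where $P_-$ is the orthogonal projection of $L^2(\mathbb T,Y)$ onto $L^2(\mathbb T,Y)\ominus H^2(\mathbb T,Y)$ and $(Jg)(z)=\bar z\,g(\bar z)$. The function $F$ is of *bounded type* if $\ker H_F^{*}=\Theta H^2(\mathbb T,Y)$ for some two-sided inner $\Theta$ with values in $\mathcal B(Y)$. For an inner $\Delta\in H^\infty(\mathbb T,\mathcal B(D_1,D))$, a *complementary factor* of $\Delta$ is a function $\Delta_c$ with values in $\mathcal B(D',D)$, for some Hilbert space $D'$, such that the row $[\Delta,\Delta_c]$, with values in $\mathcal B(D_1\oplus D',D)$, is inner and $\ker H_{\Delta^*}=[\Delta,\Delta_c]\,H^2(\mathbb T,D_1\oplus D')$. **Corollary.** Let $\Phi\in H^\infty(\mathbb T,\mathcal B(D,E_1))$ and $\Psi\in H^\infty(\mathbb T,\mathcal B(D,E_2))$, let $\Delta$ be a left-g.c.d. of $\widetilde\Phi$ and $\widetilde\Psi$, and let $\Delta_c$ be a complementary factor of $\Delta$. If $\breve\Delta$ is of bounded type, then $\widetilde{[\Delta,\Delta_c]}$ is a common right inner divisor of both $\Phi$ and $\Psi$,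 and it is nontrivial whenever $\Delta$ is not a.e. equal to a constant operator. -/

import Mathlib

noncomputable section

open MeasureTheory AddCircle
open scoped ENNReal InnerProductSpace

namespace OpHardy

/-- The unit circle, parametrized by `t ∈ ℝ/ℤ` through `z = exp (2πit)`. Thus `z ^ n` is
`fourier n t`, complex conjugation `z ↦ z̄` is `t ↦ -t`, and normalized Lebesgue measure is
`haarAddCircle`. -/
abbrev Circ : Type := UnitAddCircle

/-- Normalized Lebesgue measure on the circle. -/
abbrev m : Measure Circ := haarAddCircle

section Functions

variable {D E F : Type*}
  [NormedAddCommGroup D] [InnerProductSpace ℂ D]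
  [NormedAddCommGroup E] [InnerProductSpace ℂ E]
  [NormedAddCommGroup F] [InnerProductSpace ℂ F]

/-- `Φ ∈ L^∞(𝕋, B(D,E))`: essentially bounded and SOT-measurable. Elements are represented by
functions, and equality of elements is equality almost everywhere. -/
def IsLInf (Φ : Circ → D →L[ℂ] E) : Prop :=
  (∀ x, AEStronglyMeasurable (fun t => Φ t x) m) ∧ ∃ C : ℝ, ∀ᵐ t ∂m, ‖Φ t‖ ≤ C

/-- `Φ ∈ H^∞(𝕋, B(D,E))`: moreover the Fourier coefficients of negative index of every
`Φ(·)x` vanish. -/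
def IsHInf (Φ : Circ → D →L[ℂ] E) : Prop :=
  IsLInf Φ ∧ ∀ n : ℤ, n < 0 → ∀ x, fourierCoeff (fun t => Φ t x) n = 0

/-- `Φ̆(z) = Φ(z̄)`. -/
def breve (Φ : Circ → D →L[ℂ] E) : Circ → D →L[ℂ] E := fun t => Φ (-t)

/-- The pointwise adjoint `Φ*(z) = Φ(z)*`. -/
def star [CompleteSpace D] [CompleteSpace E] (Φ : Circ → D →L[ℂ] E) : Circ → E →L[ℂ] D :=
  fun t => ContinuousLinearMap.adjoint (Φ t)

/-- The flip `Φ̃ = (Φ̆)*`, i.e. `Φ̃(z) = Φ(z̄)*`. -/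
def tilde [CompleteSpace D] [CompleteSpace E] (Φ : Circ → D →L[ℂ] E) : Circ → E →L[ℂ] D :=
  star (breve Φ)

/-- `Δ` is inner: `Δ ∈ H^∞(𝕋, B(D,E))` and `Δ*Δ = I_D` a.e. -/
def IsInner [CompleteSpace D] [CompleteSpace E] (Δ : Circ → D →L[ℂ] E) : Prop :=
  IsHInf Δ ∧ ∀ᵐ t ∂m, star Δ t ∘L Δ t = ContinuousLinearMap.id ℂ D

/-- `Δ` is two-sided inner: moreover `ΔΔ* = I_E` a.e. -/
def IsTwoSidedInner [CompleteSpace D] [CompleteSpace E] (Δ : Circ → D →L[ℂ] E) : Prop :=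
  IsInner Δ ∧ ∀ᵐ t ∂m, Δ t ∘L star Δ t = ContinuousLinearMap.id ℂ E

/-- The inner function `Δ` (with values in `B(F,E)`) is a left inner divisor of `Φ`:
`Φ = ΔA` with `A ∈ H^∞(𝕋, B(D,F))`. -/
def IsLeftInnerDivisor [CompleteSpace E] [CompleteSpace F]
    (Δ : Circ → F →L[ℂ] E) (Φ : Circ → D →L[ℂ] E) : Prop :=
  IsInner Δ ∧ ∃ A : Circ → D →L[ℂ] F, IsHInf A ∧ ∀ᵐ t ∂m, Φ t = Δ t ∘L A t

/-- The inner function `Ω` (with values in `B(D,F)`) is a right inner divisor of `Φ`: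
`Φ = BΩ` with `B ∈ H^∞(𝕋, B(F,E))`. -/
def IsRightInnerDivisor [CompleteSpace D] [CompleteSpace F]
    (Ω : Circ → D →L[ℂ] F) (Φ : Circ → D →L[ℂ] E) : Prop :=
  IsInner Ω ∧ ∃ B : Circ → F →L[ℂ] E, IsHInf B ∧ ∀ᵐ t ∂m, Φ t = B t ∘L Ω t

/-- `Δ` is a (constant) unitary operator. An inner divisor is nontrivial if it is not one. -/
def IsUnitaryConst (Δ : Circ → D →L[ℂ] E) : Prop :=
  ∃ U : D ≃ₗᵢ[ℂ] E, ∀ᵐ t ∂m, Δ t = (U : D →L[ℂ] E)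

/-- `Δ` is constant. -/
def IsConst (Δ : Circ → D →L[ℂ] E) : Prop :=
  ∃ V : D →L[ℂ] E, ∀ᵐ t ∂m, Δ t = V

/-- The row `[Δ, Γ]`, acting by `x ⊕ y ↦ Δ(z)x + Γ(z)y` on the Hilbert space direct sum. -/
def row (Δ : Circ → D →L[ℂ] E) (Γ : Circ → F →L[ℂ] E) : Circ → WithLp 2 (D × F) →L[ℂ] E :=
  fun t => ((Δ t).coprod (Γ t)) ∘L (WithLp.prodContinuousLinearEquiv 2 ℂ D F : _ →L[ℂ] D × F)

end Functions

section GCD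

universe u

variable {D₁ E₁ E₂ : Type*} {D : Type u}
  [NormedAddCommGroup D] [InnerProductSpace ℂ D] [CompleteSpace D]
  [NormedAddCommGroup D₁] [InnerProductSpace ℂ D₁] [CompleteSpace D₁]
  [NormedAddCommGroup E₁] [InnerProductSpace ℂ E₁]
  [NormedAddCommGroup E₂] [InnerProductSpace ℂ E₂]

/-- `Δ` is a greatest common left inner divisor of `Φ` and `Ψ`: a common left inner divisor which
every common left inner divisor `Ω` divides from the left. (An inner function with values in
`B(F,D)` embeds `F` isometrically in `D`, so it is enough to let `F` range over the universe
of `D`.) -/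
def IsLeftGCD (Δ : Circ → D₁ →L[ℂ] D) (Φ : Circ → E₁ →L[ℂ] D) (Ψ : Circ → E₂ →L[ℂ] D) : Prop :=
  IsLeftInnerDivisor Δ Φ ∧ IsLeftInnerDivisor Δ Ψ ∧
    ∀ (F : Type u) [NormedAddCommGroup F] [InnerProductSpace ℂ F] [CompleteSpace F]
      (Ω : Circ → F →L[ℂ] D),
      IsLeftInnerDivisor Ω Φ → IsLeftInnerDivisor Ω Ψ → IsLeftInnerDivisor Ω Δ

end GCD

section Multiplication

variable {D E : Type*}
  [NormedAddCommGroup D] [InnerProductSpace ℂ D]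
  [NormedAddCommGroup E] [InnerProductSpace ℂ E]

theorem IsLInf.aestronglyMeasurable_apply {Φ : Circ → D →L[ℂ] E} (h : IsLInf Φ) {f : Circ → D}
    (hf : AEStronglyMeasurable f m) : AEStronglyMeasurable (fun t => Φ t (f t)) m := by
  have key : ∀ g : SimpleFunc Circ D, AEStronglyMeasurable (fun t => Φ t (g t)) m := by
    intro g
    induction g using SimpleFunc.induction with
    | const c hs =>
      refine ((h.1 c).indicator hs).congr (Filter.Eventually.of_forall fun t => ?_)
      rename_i s
      by_cases ht : t ∈ s <;> simp [SimpleFunc.piecewise_apply, ht]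
    | add _ hf hg =>
      simpa [Pi.add_def] using hf.add hg
  obtain ⟨g, hg, hfg⟩ := hf
  have h1 : AEStronglyMeasurable (fun t => Φ t (g t)) m :=
    aestronglyMeasurable_of_tendsto_ae Filter.atTop (fun n => key (hg.approx n))
      (Filter.Eventually.of_forall fun t =>
        ((Φ t).continuous.tendsto _).comp (hg.tendsto_approx t))
  exact h1.congr (hfg.mono fun t ht => by simp [ht])

theorem IsLInf.memLp_apply {Φ : Circ → D →L[ℂ] E} (h : IsLInf Φ) (f : Lp D 2 m) :
    MemLp (fun t => Φ t (f t)) 2 m := by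
  obtain ⟨C, hC⟩ := h.2
  refine (Lp.memLp f).of_le_mul (c := C)
    (h.aestronglyMeasurable_apply (Lp.aestronglyMeasurable f)) (hC.mono fun t ht => ?_)
  exact (Φ t).le_of_opNorm_le ht _

open Classical in
/-- Multiplication by `Φ ∈ L^∞(𝕋, B(D,E))`, as an operator `L²(𝕋,D) → L²(𝕋,E)`
(by convention `0` if `Φ` is not in `L^∞`). -/
def mulOp (Φ : Circ → D →L[ℂ] E) : Lp D 2 m →L[ℂ] Lp E 2 m :=
  if h : IsLInf Φ then
    LinearMap.mkContinuousOfExistsBound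
      { toFun := fun f => (h.memLp_apply f).toLp
        map_add' := fun f g => by
          rw [← MemLp.toLp_add, MemLp.toLp_eq_toLp_iff]
          filter_upwards [Lp.coeFn_add f g] with t ht
          rw [ht]
          simp
        map_smul' := fun c f => by
          rw [RingHom.id_apply, ← MemLp.toLp_const_smul, MemLp.toLp_eq_toLp_iff]
          filter_upwards [Lp.coeFn_smul c f] with t ht
          rw [ht]
          simp }
      (by
        obtain ⟨C, hC⟩ := h.2
        refine ⟨C, fun f => Lp.norm_le_mul_norm_of_ae_le_mul ?_⟩
        filter_upwards [hC, (h.memLp_apply f).coeFn_toLp] with t ht ht'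
        simp only [LinearMap.coe_mk, AddHom.coe_mk]
        rw [ht']
        exact (Φ t).le_of_opNorm_le ht _)
  else 0

theorem coeFn_mulOp {Φ : Circ → D →L[ℂ] E} (h : IsLInf Φ) (f : Lp D 2 m) :
    mulOp Φ f =ᵐ[m] fun t => Φ t (f t) := by
  rw [mulOp, dif_pos h]
  exact (h.memLp_apply f).coeFn_toLp

theorem isLInf_fourier (E : Type*) [NormedAddCommGroup E] [InnerProductSpace ℂ E] (n : ℤ) :
    IsLInf (fun t : Circ => fourier n t • ContinuousLinearMap.id ℂ E) := by
  refine ⟨fun x => ?_, 1, Filter.Eventually.of_forall fun t => ?_⟩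
  · exact ((fourier n).continuous.smul continuous_const).aestronglyMeasurable
  · rw [norm_smul]
    have h1 : ‖(fourier n t : ℂ)‖ = 1 := Circle.norm_coe _
    rw [h1, one_mul]
    exact ContinuousLinearMap.norm_id_le

end Multiplication

section Hardy

variable (E : Type*) [NormedAddCommGroup E] [InnerProductSpace ℂ E]

theorem integrable_of_L2 {E : Type*} [NormedAddCommGroup E] (f : Lp E 2 m) : Integrable f m :=
  (Lp.memLp f).integrable (by norm_num)

/-- The Hardy space `H²(𝕋,E)`: the functions in `L²(𝕋,E)` whose Fourier coefficients of
negative index vanish. -/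
def H2 : Submodule ℂ (Lp E 2 m) where
  carrier := {f | ∀ n : ℤ, n < 0 → fourierCoeff f n = 0}
  zero_mem' := fun n _ => by
    have h : fourierCoeff (0 : Lp E 2 m) n = ∫ _ : Circ, (0 : E) ∂m :=
      integral_congr_ae ((Lp.coeFn_zero E 2 m).mono fun t ht => by beta_reduce; rw [ht]; simp)
    simpa using h
  add_mem' := fun {f g} hf hg n hn => by
    have h : fourierCoeff (f + g : Lp E 2 m) n = fourierCoeff (⇑f + ⇑g) n :=
      integral_congr_ae ((Lp.coeFn_add f g).mono fun t ht => by simp only [ht])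
    rw [h, fourierCoeff.add (integrable_of_L2 f) (integrable_of_L2 g)]
    simp [hf n hn, hg n hn]
  smul_mem' := fun c f hf n hn => by
    have h : fourierCoeff (c • f : Lp E 2 m) n = fourierCoeff (c • ⇑f) n :=
      integral_congr_ae ((Lp.coeFn_smul c f).mono fun t ht => by simp only [ht])
    rw [h, fourierCoeff.const_smul, hf n hn, smul_zero]

variable {E}

theorem memLp_monomial {E : Type*} [NormedAddCommGroup E] [InnerProductSpace ℂ E]
    (n : ℤ) (x : E) : MemLp (fun t : Circ => fourier n t • x) 2 m :=
  (((fourier n).continuous.smul continuous_const).memLp_of_hasCompactSupport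
    (HasCompactSupport.of_compactSpace _))

/-- The monomial `z ^ n x`. -/
def monomial (n : ℤ) (x : E) : Lp E 2 m := (memLp_monomial n x).toLp

variable [CompleteSpace E]

theorem inner_monomial (n : ℤ) (x : E) (f : Lp E 2 m) :
    ⟪monomial n x, f⟫_ℂ = ⟪x, fourierCoeff f n⟫_ℂ := by
  have h1 : Integrable (fun t : Circ => fourier (-n) t • f t) m :=
    (integrable_of_L2 f).fourier_smul (-n)
  rw [L2.inner_def, fourierCoeff, ← integral_inner h1]
  refine integral_congr_ae ?_
  filter_upwards [(memLp_monomial n x).coeFn_toLp] with t ht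
  rw [monomial, ht, inner_smul_left, inner_smul_right, fourier_neg]

theorem mem_H2_iff (f : Lp E 2 m) :
    f ∈ H2 E ↔ ∀ n : ℤ, n < 0 → ∀ x : E, ⟪monomial n x, f⟫_ℂ = 0 := by
  refine forall₂_congr fun n _ => ?_
  simp only [inner_monomial]
  exact ⟨fun h x => by simp [h], fun h => by simpa using h (fourierCoeff f n)⟩

instance : CompleteSpace (H2 E) := by
  have h : IsClosed (H2 E : Set (Lp E 2 m)) := by
    have : (H2 E : Set (Lp E 2 m)) =
        ⋂ (n : ℤ) (_ : n < 0) (x : E), {f | ⟪monomial n x, f⟫_ℂ = 0} := by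
      ext f
      simp only [Set.mem_iInter]
      exact mem_H2_iff f
    rw [this]
    exact isClosed_iInter fun n => isClosed_iInter fun _ => isClosed_iInter fun x =>
      isClosed_eq (continuous_const.inner continuous_id) continuous_const
  exact h.completeSpace_coe

variable (E)

/-- `P₋`: the orthogonal projection of `L²(𝕋,E)` onto `L²(𝕋,E) ⊖ H²(𝕋,E)`. -/
def projMinus : Lp E 2 m →L[ℂ] Lp E 2 m := (H2 E)ᗮ.starProjection

theorem measurePreserving_neg : MeasurePreserving (fun t : Circ => -t) m m :=
  Measure.measurePreserving_neg m

/-- The unitary operator `(Jg)(z) = z̄ g(z̄)` on `L²(𝕋,E)`. -/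
def J : Lp E 2 m →L[ℂ] Lp E 2 m :=
  mulOp (fun t => fourier (-1) t • ContinuousLinearMap.id ℂ E) ∘L
    (Lp.compMeasurePreservingₗᵢ ℂ (fun t : Circ => -t)
      measurePreserving_neg).toContinuousLinearMap

variable {E}

theorem coeFn_J {E : Type*} [NormedAddCommGroup E] [InnerProductSpace ℂ E] (g : Lp E 2 m) : J E g =ᵐ[m] fun t => (fourier (-1) t : ℂ) • g (-t) := by
  have h1 := coeFn_mulOp (isLInf_fourier E (-1))
    (Lp.compMeasurePreserving (fun t : Circ => -t) measurePreserving_neg g)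
  have h2 := Lp.coeFn_compMeasurePreserving g measurePreserving_neg
  filter_upwards [h1, h2] with t ht1 ht2
  refine ht1.trans ?_
  rw [ht2]
  simp

theorem J_mem_H2 {g : Lp E 2 m} (hg : g ∈ (H2 E)ᗮ) : J E g ∈ H2 E := by
  intro n hn
  have h0 : monomial (-(n + 1)) (fourierCoeff g (-(n + 1))) ∈ H2 E := by
    intro k hk
    have hne : k ≠ -(n + 1) := by omega
    set x := fourierCoeff g (-(n + 1))
    have h2 : fourierCoeff (monomial (-(n + 1)) x) k
        = ∫ t : Circ, ((fourier (-k) t : ℂ) • fourier (-(n + 1)) t) • x ∂m := by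
      refine integral_congr_ae ((memLp_monomial (-(n + 1)) x).coeFn_toLp.mono fun t ht => ?_)
      simp only [monomial, ht, smul_assoc]
    rw [h2, integral_smul_const]
    have h3 : fourierCoeff (fourier (T := 1) (-(n + 1))) k = 0 := by
      rw [fourierCoeff_fourier, Pi.single_eq_of_ne hne]
    rw [fourierCoeff] at h3
    rw [h3, zero_smul]
  have h1 : fourierCoeff g (-(n + 1)) = 0 := by
    have := Submodule.inner_right_of_mem_orthogonal h0 hg
    rwa [inner_monomial, inner_self_eq_zero] at this
  rw [← h1]
  calc fourierCoeff (J E g) n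
      = ∫ t : Circ, (fourier (n + 1) (-t) : ℂ) • g (-t) ∂m := by
        refine integral_congr_ae ((coeFn_J g).mono fun t ht => ?_)
        simp only [ht, smul_smul, ← fourier_add]
        congr 1
        rw [fourier_apply, fourier_apply, smul_neg, ← neg_smul, neg_add]
    _ = fourierCoeff g (-(n + 1)) := by
        rw [fourierCoeff, neg_neg]
        exact integral_neg_eq_self (μ := m) (fun t : Circ => (fourier (n + 1) t : ℂ) • g t)

end Hardy

section Hankel

variable {D E F : Type*}
  [NormedAddCommGroup D] [InnerProductSpace ℂ D] [CompleteSpace D]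
  [NormedAddCommGroup E] [InnerProductSpace ℂ E] [CompleteSpace E]
  [NormedAddCommGroup F] [InnerProductSpace ℂ F] [CompleteSpace F]

/-- The Hankel operator `H_Φ : H²(𝕋,D) → H²(𝕋,E)`, `H_Φ f = J P₋(Φf)`. -/
def hankel (Φ : Circ → D →L[ℂ] E) : H2 D →L[ℂ] H2 E :=
  (J E ∘L projMinus E ∘L mulOp Φ ∘L (H2 D).subtypeL).codRestrict (H2 E)
    (fun _ => J_mem_H2 (Submodule.starProjection_apply_mem _ _))

/-- The kernel of an operator from `H²(𝕋,D)` to `H²(𝕋,E)`, as a subspace of `L²(𝕋,D)`. -/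
def kerL2 (T : H2 D →L[ℂ] H2 E) : Submodule ℂ (Lp D 2 m) :=
  (LinearMap.ker T.toLinearMap).map (H2 D).subtype

/-- `Θ H²(𝕋,D)`. -/
def mulH2 (Θ : Circ → D →L[ℂ] E) : Submodule ℂ (Lp E 2 m) :=
  (H2 D).map (mulOp Θ).toLinearMap

/-- `Φ ∈ L^∞(𝕋, B(D,E))` is of bounded type: `ker H_Φ^* = Θ H²(𝕋,E)` for some two-sided inner
function `Θ` with values in `B(E)`. Here `H_Φ^*` is the adjoint of `H_Φ`. -/
def IsBoundedType (Φ : Circ → D →L[ℂ] E) : Prop :=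
  IsLInf Φ ∧ ∃ Θ : Circ → E →L[ℂ] E, IsTwoSidedInner Θ ∧
    kerL2 (ContinuousLinearMap.adjoint (hankel Φ)) = mulH2 Θ

/-- `Γ` is a complementary factor of the inner function `Δ`: `[Δ, Γ]` is the inner function which
represents the shift-invariant subspace `ker H_{Δ*}`, that is `ker H_{Δ*} = [Δ, Γ] H²(𝕋, D ⊕ F)`. -/
def IsComplementaryFactor (Δ : Circ → D →L[ℂ] E) (Γ : Circ → F →L[ℂ] E) : Prop :=
  IsInner (row Δ Γ) ∧ kerL2 (hankel (star Δ)) = mulH2 (row Δ Γ)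

end Hankel

end OpHardy

end

namespace OpHardy

open MeasureTheory AddCircle Filter
open scoped ENNReal InnerProductSpace

/-! ### Measurability and Fourier coefficients of adjoints and flips -/

section Measurability

/-! The adjoint of a Hankel operator is the Hankel operator of the flipped symbol
(`adjoint_hankel`), so `H_Δ̆^* = H_{Δ*}`. Bounded type of `Δ̆` therefore gives `[Δ, Δc] H² = ker
H_{Δ*} = Θ H²` with `Θ` two-sided inner. Since the values of `Θ` are a.e. onto, so are those of the
inner function `[Δ, Δc]`, which is thus two-sided inner (`IsInner.isTwoSidedInner_of_mulH2_le`), and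
its flip is again inner. If `Φ̃ = ΔA`, then `Φ = Ã Δ̃`. As `Δ̃` is the first entry of the column
`[Δ, Δc]~`, this reads `Φ = [Ã, 0] [Δ, Δc]~`; likewise for `Ψ`. If the column were constant, so
would be its first entry, hence `Δ`. -/

theorem _root_.HilbertBasis.countable {ι E : Type*} [NormedAddCommGroup E] [InnerProductSpace ℂ E]
    [TopologicalSpace.SeparableSpace E] (b : HilbertBasis ι ℂ E) : Countable ι := by
  -- Distinct basis vectors are at distance `√2`, so these balls are disjoint.
  have hdisj : (Set.univ : Set ι).PairwiseDisjoint fun i => Metric.ball (b i) (1 / 2) := by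
    intro i _ j _ hij
    refine Metric.ball_disjoint_ball ?_
    have h : ‖b i - b j‖ ^ 2 = 2 := by
      rw [@norm_sub_sq ℂ, b.orthonormal.1 i, b.orthonormal.1 j, b.orthonormal.2 hij]
      norm_num
    rw [dist_eq_norm]
    nlinarith [norm_nonneg (b i - b j)]
  refine Set.countable_univ_iff.mp (hdisj.countable_of_isOpen (fun _ _ => Metric.isOpen_ball) ?_)
  exact fun i _ => Metric.nonempty_ball.mpr (by norm_num)

/-- A weakly measurable function with values in a separable Hilbert space is strongly
measurable. -/
theorem aestronglyMeasurable_of_inner {α E : Type*} [MeasurableSpace α] {μ : Measure α}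
    [NormedAddCommGroup E] [InnerProductSpace ℂ E] [CompleteSpace E]
    [TopologicalSpace.SeparableSpace E] {f : α → E}
    (hf : ∀ x, AEStronglyMeasurable (fun t => ⟪x, f t⟫_ℂ) μ) : AEStronglyMeasurable f μ := by
  obtain ⟨w, b, -⟩ := exists_hilbertBasis ℂ E
  have : Countable w := b.countable
  refine aestronglyMeasurable_of_tendsto_ae (atTop : Filter (Finset w))
    (f := fun s t => ∑ i ∈ s, ⟪b i, f t⟫_ℂ • b i) (fun s => ?_)
    (Eventually.of_forall fun t => ?_)
  · exact Finset.aestronglyMeasurable_fun_sum s fun i _ => (hf (b i)).smul_const (b i)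
  · simpa only [HasSum, SummationFilter.unconditional_filter, b.repr_apply_apply]
      using b.hasSum_repr (f t)

variable {D E : Type*}
  [NormedAddCommGroup D] [InnerProductSpace ℂ D]
  [NormedAddCommGroup E] [InnerProductSpace ℂ E]

theorem IsLInf.breve {Φ : Circ → D →L[ℂ] E} (h : IsLInf Φ) : IsLInf (breve Φ) := by
  obtain ⟨C, hC⟩ := h.2
  refine ⟨fun x => ?_, C, ?_⟩
  · exact (h.1 x).comp_measurePreserving measurePreserving_neg
  · have h' := measurePreserving_neg.quasiMeasurePreserving.ae hC
    exact h'

theorem IsLInf.integrable_apply {Φ : Circ → D →L[ℂ] E} (h : IsLInf Φ) (x : D) :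
    Integrable (fun t => Φ t x) m := by
  obtain ⟨C, hC⟩ := h.2
  exact Integrable.of_bound (h.1 x) (C * ‖x‖) (hC.mono fun t ht => (Φ t).le_of_opNorm_le ht x)

variable [CompleteSpace D] [CompleteSpace E]

theorem IsLInf.star [TopologicalSpace.SeparableSpace D] {Φ : Circ → D →L[ℂ] E} (h : IsLInf Φ) :
    IsLInf (star Φ) := by
  obtain ⟨C, hC⟩ := h.2
  refine ⟨fun y => aestronglyMeasurable_of_inner fun x => ?_, C, hC.mono fun t ht => ?_⟩
  · simp only [OpHardy.star, ContinuousLinearMap.adjoint_inner_right]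
    exact (h.1 x).inner aestronglyMeasurable_const
  · rwa [OpHardy.star, LinearIsometryEquiv.norm_map]

theorem IsLInf.tilde [TopologicalSpace.SeparableSpace D] {Φ : Circ → D →L[ℂ] E} (h : IsLInf Φ) :
    IsLInf (tilde Φ) :=
  h.breve.star

/-- The Fourier coefficients of `Φ̃` of negative index vanish if those of `Φ` do. -/
theorem IsHInf.fourierCoeff_tilde {Φ : Circ → D →L[ℂ] E} (h : IsHInf Φ) {y : E}
    (hy : Integrable (fun t => tilde Φ t y) m) {n : ℤ} (hn : n < 0) :
    fourierCoeff (fun t => tilde Φ t y) n = 0 := by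
  refine ext_inner_left ℂ fun x => ?_
  have hx : Integrable (fun t : Circ => fourier (-n) t • Φ t x) m :=
    (h.1.integrable_apply x).fourier_smul (-n)
  -- Conjugation and `t ↦ -t` both reverse the sign of the frequency, so the index `n` is preserved.
  have hconj : ∀ t : Circ, ⟪x, fourier (-n) t • tilde Φ t y⟫_ℂ
      = starRingEnd ℂ ⟪y, fourier (-n) (-t) • Φ (-t) x⟫_ℂ := by
    intro t
    have hneg : (fourier (-n) (-t) : ℂ) = fourier n t := by
      simp only [fourier_apply, smul_neg, neg_smul, neg_neg]
    rw [inner_smul_right, inner_smul_right, hneg, map_mul, inner_conj_symm, ← fourier_neg,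
      tilde, OpHardy.star, ContinuousLinearMap.adjoint_inner_right, OpHardy.breve]
  rw [fourierCoeff, ← integral_inner (hy.fourier_smul (-n)), inner_zero_right,
    integral_congr_ae (Eventually.of_forall hconj), integral_conj,
    integral_neg_eq_self (μ := m) (fun t : Circ => ⟪y, fourier (-n) t • Φ t x⟫_ℂ),
    integral_inner hx]
  have h0 := h.2 n hn x
  rw [fourierCoeff] at h0
  rw [h0, inner_zero_right, map_zero]

theorem IsHInf.tilde [TopologicalSpace.SeparableSpace D] {Φ : Circ → D →L[ℂ] E} (h : IsHInf Φ) :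
    IsHInf (tilde Φ) :=
  ⟨h.1.tilde, fun _ hn y => h.fourierCoeff_tilde (h.1.tilde.integrable_apply y) hn⟩

end Measurability

/-! ### Inner functions and their ranges -/

section Inner

variable {D E F : Type*}
  [NormedAddCommGroup D] [InnerProductSpace ℂ D] [CompleteSpace D]
  [NormedAddCommGroup E] [InnerProductSpace ℂ E] [CompleteSpace E]
  [NormedAddCommGroup F] [InnerProductSpace ℂ F] [CompleteSpace F]

theorem norm_apply_of_adjoint_comp_self {T : D →L[ℂ] E}
    (hT : ContinuousLinearMap.adjoint T ∘L T = ContinuousLinearMap.id ℂ D) (x : D) :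
    ‖T x‖ = ‖x‖ :=
  T.norm_map_iff_adjoint_comp_self.mpr hT x

/-- Almost every value embeds `D` isometrically in `E`. This supplies the separability needed for
adjoints to be SOT-measurable. -/
theorem IsInner.separableSpace [TopologicalSpace.SeparableSpace E] {Δ : Circ → D →L[ℂ] E}
    (h : IsInner Δ) : TopologicalSpace.SeparableSpace D := by
  obtain ⟨t, ht⟩ := h.2.exists
  have hiso : Isometry (Δ t) :=
    AddMonoidHomClass.isometry_of_norm (Δ t) (norm_apply_of_adjoint_comp_self ht)
  have := UniformSpace.secondCountable_of_separable E
  have := hiso.isEmbedding.secondCountableTopology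
  infer_instance

theorem IsTwoSidedInner.tilde [TopologicalSpace.SeparableSpace E] {Δ : Circ → D →L[ℂ] E}
    (h : IsTwoSidedInner Δ) : IsTwoSidedInner (tilde Δ) := by
  have := h.1.separableSpace
  have hneg := measurePreserving_neg.quasiMeasurePreserving
  refine ⟨⟨h.1.1.tilde, (hneg.ae h.2).mono fun t ht => ?_⟩, (hneg.ae h.1.2).mono fun t ht => ?_⟩
  · simpa only [OpHardy.tilde, OpHardy.star, OpHardy.breve,
      ContinuousLinearMap.adjoint_adjoint] using ht
  · simpa only [OpHardy.tilde, OpHardy.star, OpHardy.breve,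
      ContinuousLinearMap.adjoint_adjoint] using ht

theorem monomial_mem_H2 {n : ℤ} (hn : 0 ≤ n) (x : E) : monomial n x ∈ H2 E := by
  intro k hk
  have hne : k ≠ n := by omega
  have h2 : fourierCoeff (monomial n x) k
      = ∫ t : Circ, ((fourier (-k) t : ℂ) • fourier n t) • x ∂m := by
    refine integral_congr_ae ((memLp_monomial n x).coeFn_toLp.mono fun t ht => ?_)
    simp only [monomial, ht, smul_assoc]
  have h3 : fourierCoeff (fourier (T := 1) n) k = 0 := by
    rw [fourierCoeff_fourier, Pi.single_eq_of_ne hne]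
  rw [fourierCoeff] at h3
  rw [h2, integral_smul_const, h3, zero_smul]

/-- An inner function whose range contains the range of a two-sided inner function is itself
two-sided inner. -/
theorem IsInner.isTwoSidedInner_of_mulH2_le [TopologicalSpace.SeparableSpace E]
    {R : Circ → D →L[ℂ] E} {Θ : Circ → F →L[ℂ] E} (hR : IsInner R) (hΘ : IsTwoSidedInner Θ)
    (hle : mulH2 Θ ≤ mulH2 R) : IsTwoSidedInner R := by
  have := hΘ.1.separableSpace
  refine ⟨hR, ?_⟩
  -- Test the inclusion on constant functions. The exceptional null set depends on `x`; a countable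
  -- dense set of `x` and closedness of the range of `R t` then yield a single null set.
  have hmem : ∀ x : F, ∀ᵐ t ∂m, Θ t x ∈ Set.range (R t) := by
    intro x
    obtain ⟨f, -, hf⟩ := hle (Submodule.mem_map_of_mem (monomial_mem_H2 le_rfl x))
    have hf' : mulOp R f = mulOp Θ (monomial 0 x) := hf
    filter_upwards [coeFn_mulOp hR.1.1 f, coeFn_mulOp hΘ.1.1.1 (monomial 0 x),
      (memLp_monomial 0 x).coeFn_toLp] with t h1 h2 h3
    refine ⟨f t, ?_⟩
    rw [← h1, hf', h2, monomial, h3, fourier_zero, one_smul]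
  have hdense : ∀ᵐ t ∂m, ∀ n, Θ t (TopologicalSpace.denseSeq F n) ∈ Set.range (R t) :=
    ae_all_iff.mpr fun n => hmem _
  filter_upwards [hdense, hR.2, hΘ.2] with t hd hRt hΘt
  have hiso : Isometry (R t) :=
    AddMonoidHomClass.isometry_of_norm (R t) (norm_apply_of_adjoint_comp_self hRt)
  have hclosed : IsClosed (Θ t ⁻¹' Set.range (R t)) :=
    hiso.isClosedEmbedding.isClosed_range.preimage (Θ t).continuous
  have huniv : ∀ x, Θ t x ∈ Set.range (R t) := fun x =>
    closure_minimal (Set.range_subset_iff.mpr hd : _ ⊆ Θ t ⁻¹' Set.range (R t)) hclosed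
      (TopologicalSpace.denseRange_denseSeq F x)
  ext y
  -- `y = ΘΘ*y` lies in the range of the isometry `R t`, on which `RR*` is the identity.
  obtain ⟨z, hz⟩ := huniv (star Θ t y)
  have hy : R t z = y := hz.trans (DFunLike.congr_fun hΘt y)
  have hzz : star R t (R t z) = z := DFunLike.congr_fun hRt z
  rw [ContinuousLinearMap.comp_apply, ← hy, hzz, ContinuousLinearMap.id_apply]

end Inner

/-! ### The flip `J` and adjoints of Hankel operators -/

section Hankel

variable {D E : Type*}
  [NormedAddCommGroup D] [InnerProductSpace ℂ D]
  [NormedAddCommGroup E] [InnerProductSpace ℂ E]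

theorem inner_J_left (f g : Lp E 2 m) : ⟪J E f, g⟫_ℂ = ⟪f, J E g⟫_ℂ := by
  rw [L2.inner_def, L2.inner_def,
    ← integral_neg_eq_self (μ := m) (fun t : Circ => ⟪f t, J E g t⟫_ℂ)]
  refine integral_congr_ae ?_
  filter_upwards [coeFn_J f, measurePreserving_neg.quasiMeasurePreserving.ae (coeFn_J g)]
    with t h1 h2
  rw [h1, h2, neg_neg, inner_smul_left, inner_smul_right, ← fourier_neg]
  congr 1
  simp only [fourier_apply, smul_neg, neg_smul, neg_neg]

theorem fourierCoeff_J (g : Lp E 2 m) (n : ℤ) :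
    fourierCoeff (J E g) n = fourierCoeff g (-(n + 1)) := by
  calc fourierCoeff (J E g) n
      = ∫ t : Circ, (fourier (n + 1) (-t) : ℂ) • g (-t) ∂m := by
        refine integral_congr_ae ((coeFn_J g).mono fun t ht => ?_)
        simp only [ht, smul_smul, ← fourier_add]
        congr 1
        rw [fourier_apply, fourier_apply, smul_neg, ← neg_smul, neg_add]
    _ = fourierCoeff g (-(n + 1)) := by
        rw [fourierCoeff, neg_neg]
        exact integral_neg_eq_self (μ := m) (fun t : Circ => (fourier (n + 1) t : ℂ) • g t)

theorem ae_eq_zero_of_fourierCoeff_eq_zero {f : Circ → ℂ} (hf : MemLp f 2 m)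
    (h : ∀ n, fourierCoeff f n = 0) : f =ᵐ[m] 0 := by
  have h0 : hf.toLp = 0 := by
    refine fourierBasis.repr.map_eq_zero_iff.mp (lp.ext (funext fun n => ?_))
    rw [fourierBasis_repr]
    exact (congrFun (fourierCoeff_congr_ae hf.coeFn_toLp) n).trans (h n)
  exact hf.coeFn_toLp.symm.trans ((Lp.eq_zero_iff_ae_eq_zero).mp h0)

variable [CompleteSpace E]

theorem eq_zero_of_fourierCoeff_eq_zero {f : Lp E 2 m} (h : ∀ n, fourierCoeff f n = 0) :
    f = 0 := by
  have hweak : ∀ x : E, (fun t => ⟪x, f t⟫_ℂ) =ᵐ[m] 0 := by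
    intro x
    refine ae_eq_zero_of_fourierCoeff_eq_zero ((Lp.memLp f).const_inner x) fun n => ?_
    have h1 := integral_inner (𝕜 := ℂ) ((integrable_of_L2 f).fourier_smul (-n)) x
    have h2 := h n
    rw [fourierCoeff] at h2
    rw [h2, inner_zero_right] at h1
    rw [← h1, fourierCoeff]
    simp only [inner_smul_right, smul_eq_mul]
  -- `E` may be nonseparable, so the null sets of `hweak` cannot be merged; integrals over sets
  -- avoid this.
  refine (Lp.eq_zero_iff_ae_eq_zero).mpr
    ((integrable_of_L2 f).ae_eq_zero_of_forall_setIntegral_eq_zero fun s _ _ => ?_)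
  refine ext_inner_left ℂ fun x => ?_
  rw [← integral_inner (integrable_of_L2 f).integrableOn, inner_zero_right,
    integral_congr_ae (ae_restrict_of_ae (hweak x))]
  simp

/-- `J` moves index `-(n + 1)` to `n`, so it exchanges negative and nonnegative indices. The
projection of `J g` to `H2 E` then has no nonzero coefficient. -/
theorem J_mem_H2_orthogonal {g : Lp E 2 m} (hg : g ∈ H2 E) : J E g ∈ (H2 E)ᗮ := by
  have hu : (H2 E).starProjection (J E g) = 0 := by
    refine eq_zero_of_fourierCoeff_eq_zero fun n => ?_
    rcases lt_or_ge n 0 with hn | hn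
    · exact Submodule.starProjection_apply_mem (H2 E) _ n hn
    · refine ext_inner_left ℂ fun x => ?_
      have h := Submodule.inner_right_of_mem_orthogonal (monomial_mem_H2 hn x)
        (Submodule.sub_starProjection_mem_orthogonal (K := H2 E) (J E g))
      rw [inner_sub_right, inner_monomial, inner_monomial, fourierCoeff_J,
        hg _ (by omega), inner_zero_right, zero_sub, neg_eq_zero] at h
      rw [h, inner_zero_right]
  have h := Submodule.sub_starProjection_mem_orthogonal (K := H2 E) (J E g)
  rwa [hu, sub_zero] at h

/-- `⟪H_Φ f, g⟫ = ⟪Φ f, J g⟫`. -/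
theorem inner_hankel_left (Φ : Circ → D →L[ℂ] E) (f : H2 D) (g : H2 E) :
    ⟪hankel Φ f, g⟫_ℂ = ⟪mulOp Φ f, J E g⟫_ℂ := by
  have h : (hankel Φ f : Lp E 2 m) = J E (projMinus E (mulOp Φ f)) := rfl
  -- `J` is self-adjoint and `J g` is already orthogonal to `H2 E`, so `P₋` drops out.
  rw [Submodule.coe_inner, h, inner_J_left, projMinus,
    Submodule.inner_starProjection_left_eq_right,
    Submodule.starProjection_eq_self_iff.mpr (J_mem_H2_orthogonal g.2)]

/-- The adjoint of the Hankel operator with symbol `Φ` is the Hankel operator with symbol `Φ̃`. -/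
theorem adjoint_hankel [CompleteSpace D] {Φ : Circ → D →L[ℂ] E} (hΦ : IsLInf Φ) (hΦt : IsLInf (tilde Φ)) :
    ContinuousLinearMap.adjoint (hankel Φ) = hankel (tilde Φ) := by
  refine (ContinuousLinearMap.eq_adjoint_iff _ _).mpr (fun g f => ?_) |>.symm
  -- What remains is `⟪Φ̃g, Jf⟫ = ⟪Jg, Φf⟫`, where the integrands agree pointwise after `t ↦ -t`.
  rw [inner_hankel_left, ← inner_conj_symm g, inner_hankel_left, inner_conj_symm]
  rw [L2.inner_def, L2.inner_def,
    ← integral_neg_eq_self (μ := m) (fun t : Circ => ⟪J E g t, mulOp Φ f t⟫_ℂ)]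
  have hneg := measurePreserving_neg.quasiMeasurePreserving
  refine integral_congr_ae ?_
  filter_upwards [coeFn_J (g : Lp E 2 m), hneg.ae (coeFn_J (g : Lp E 2 m)),
    coeFn_J (f : Lp D 2 m), hneg.ae (coeFn_mulOp hΦ (f : Lp D 2 m)),
    coeFn_mulOp hΦt (g : Lp E 2 m)] with t h1 h2 h3 h4 h5
  rw [h2, h3, h4, h5, neg_neg, tilde, OpHardy.star, ContinuousLinearMap.adjoint_inner_left,
    OpHardy.breve, map_smul, inner_smul_left, inner_smul_right, ← fourier_neg]
  congr 1
  simp only [fourier_apply, smul_neg, neg_smul, neg_neg]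

end Hankel

/-! ### The row `[Δ, Γ]` and the divisors it yields -/

section Row

variable {D E F G : Type*}
  [NormedAddCommGroup D] [InnerProductSpace ℂ D] [CompleteSpace D]
  [NormedAddCommGroup E] [InnerProductSpace ℂ E] [CompleteSpace E]
  [NormedAddCommGroup F] [InnerProductSpace ℂ F] [CompleteSpace F]
  [NormedAddCommGroup G] [InnerProductSpace ℂ G] [CompleteSpace G]

theorem fst_star_row (Δ : Circ → D →L[ℂ] E) (Γ : Circ → F →L[ℂ] E) (t : Circ) (y : E) :
    (star (row Δ Γ) t y).fst = star Δ t y := by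
  refine ext_inner_left ℂ fun x => ?_
  have h : ⟪WithLp.toLp 2 (x, (0 : F)), star (row Δ Γ) t y⟫_ℂ
      = ⟪x, (star (row Δ Γ) t y).fst⟫_ℂ := by
    rw [WithLp.prod_inner_apply]
    simp
  rw [← h, star, star, ContinuousLinearMap.adjoint_inner_right,
    ContinuousLinearMap.adjoint_inner_right]
  simp [row]

/-- `ker H_{Δ*}` is represented both by the row and, since `H_{Δ*}` is the adjoint of `H_Δ̆`, by a
two-sided inner function. -/
theorem IsComplementaryFactor.isTwoSidedInner_row [TopologicalSpace.SeparableSpace E]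
    {Δ : Circ → D →L[ℂ] E} {Γ : Circ → F →L[ℂ] E} (hΔ : IsInner Δ)
    (hΓ : IsComplementaryFactor Δ Γ) (hbt : IsBoundedType (breve Δ)) :
    IsTwoSidedInner (row Δ Γ) := by
  have := hΔ.separableSpace
  obtain ⟨-, Θ, hΘ, hker⟩ := hbt
  have htilde : tilde (breve Δ) = star Δ := by
    funext t
    simp only [tilde, star, breve, neg_neg]
  have hadj := adjoint_hankel hΔ.1.1.breve (by rw [htilde]; exact hΔ.1.1.star)
  rw [hadj, htilde, hΓ.2] at hker
  exact hΓ.1.isTwoSidedInner_of_mulH2_le hΘ hker.ge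

theorem isRightInnerDivisor_tilde_row [TopologicalSpace.SeparableSpace D]
    {Φ : Circ → D →L[ℂ] G} (hΦ : IsHInf Φ) {Δ : Circ → E →L[ℂ] D} {Γ : Circ → F →L[ℂ] D}
    (hdiv : IsLeftInnerDivisor Δ (tilde Φ)) (hrow : IsTwoSidedInner (row Δ Γ)) :
    IsRightInnerDivisor (tilde (row Δ Γ)) Φ := by
  obtain ⟨hΔ, A, hA, hfac⟩ := hdiv
  have hneg := measurePreserving_neg.quasiMeasurePreserving
  have hadj : ∀ᵐ t ∂m, Φ t = tilde A t ∘L tilde Δ t := by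
    filter_upwards [hneg.ae hfac] with t ht
    have h := congrArg ContinuousLinearMap.adjoint ht
    rwa [ContinuousLinearMap.adjoint_comp, tilde, star, breve, neg_neg,
      ContinuousLinearMap.adjoint_adjoint] at h
  have hΔneg : ∀ᵐ t ∂m, tilde Δ t ∘L breve Δ t = ContinuousLinearMap.id ℂ E := by
    have h := hneg.ae hΔ.2
    exact h
  -- `A` acts on the possibly nonseparable space `G`, so measurability of `Ã` is not automatic; it
  -- is read off from `Ã = ΦΔ̆`.
  have hAeq : ∀ᵐ t ∂m, Φ t ∘L breve Δ t = tilde A t := by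
    filter_upwards [hadj, hΔneg] with t h1 h2
    rw [h1, ContinuousLinearMap.comp_assoc, h2, ContinuousLinearMap.comp_id]
  have hAL : IsLInf (tilde A) := by
    refine ⟨fun x => ?_, ?_⟩
    · exact (hΦ.1.aestronglyMeasurable_apply (hΔ.1.1.breve.1 x)).congr
        (hAeq.mono fun t ht => DFunLike.congr_fun ht x)
    · obtain ⟨C, hC⟩ := hA.1.breve.2
      refine ⟨C, hC.mono fun t ht => ?_⟩
      rwa [tilde, star, LinearIsometryEquiv.norm_map]
  -- The cofactor is `[Ã, 0]`: it keeps only the first entry `Δ̃` of the column.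
  refine ⟨hrow.tilde.1, fun t => tilde A t ∘L WithLp.fstL 2 ℂ E F, ⟨⟨fun x => hAL.1 x.fst, ?_⟩,
    fun n hn x => hA.fourierCoeff_tilde (hAL.integrable_apply x.fst) hn⟩, ?_⟩
  · obtain ⟨C, hC⟩ := hAL.2
    refine ⟨C * ‖WithLp.fstL 2 ℂ E F‖, hC.mono fun t ht => ?_⟩
    exact (ContinuousLinearMap.opNorm_comp_le _ _).trans (by gcongr)
  · filter_upwards [hadj] with t ht
    ext x
    have h : (tilde (row Δ Γ) t x).fst = tilde Δ t x := fst_star_row Δ Γ (-t) x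
    rw [ht]
    simp only [ContinuousLinearMap.comp_apply, WithLp.fstL_apply, h]

/-- `Δ` is the row restricted to the first summand, and the row is then a.e. the constant `U*`. -/
theorem isConst_of_isUnitaryConst_tilde_row {Δ : Circ → D →L[ℂ] E} {Γ : Circ → F →L[ℂ] E}
    (h : IsUnitaryConst (tilde (row Δ Γ))) : IsConst Δ := by
  obtain ⟨U, hU⟩ := h
  let ι : D →L[ℂ] WithLp 2 (D × F) :=
    ((WithLp.prodContinuousLinearEquiv 2 ℂ D F).symm : D × F →L[ℂ] WithLp 2 (D × F)) ∘L
      ContinuousLinearMap.inl ℂ D F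
  refine ⟨ContinuousLinearMap.adjoint (U : E →L[ℂ] WithLp 2 (D × F)) ∘L ι, ?_⟩
  filter_upwards [measurePreserving_neg.quasiMeasurePreserving.ae hU] with t ht
  rw [← ht, tilde, star, breve, neg_neg, ContinuousLinearMap.adjoint_adjoint]
  ext x
  simp [row, ι]

end Row

end OpHardy

theorem corollary5p3
    {D D₁ D' E₁ E₂ : Type*}
    [NormedAddCommGroup D] [InnerProductSpace ℂ D] [CompleteSpace D]
    [TopologicalSpace.SeparableSpace D]
    [NormedAddCommGroup D₁] [InnerProductSpace ℂ D₁] [CompleteSpace D₁]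
    [NormedAddCommGroup D'] [InnerProductSpace ℂ D'] [CompleteSpace D']
    [NormedAddCommGroup E₁] [InnerProductSpace ℂ E₁] [CompleteSpace E₁]
    [NormedAddCommGroup E₂] [InnerProductSpace ℂ E₂] [CompleteSpace E₂]
    (Φ : OpHardy.Circ → D →L[ℂ] E₁) (hΦ : OpHardy.IsHInf Φ)
    (Ψ : OpHardy.Circ → D →L[ℂ] E₂) (hΨ : OpHardy.IsHInf Ψ)
    (Δ : OpHardy.Circ → D₁ →L[ℂ] D)
    (hΔ : OpHardy.IsLeftGCD Δ (OpHardy.tilde Φ) (OpHardy.tilde Ψ))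
    (hbt : OpHardy.IsBoundedType (OpHardy.breve Δ))
    (Δc : OpHardy.Circ → D' →L[ℂ] D)
    (hΔc : OpHardy.IsComplementaryFactor Δ Δc) :
    OpHardy.IsRightInnerDivisor (OpHardy.tilde (OpHardy.row Δ Δc)) Φ ∧
      OpHardy.IsRightInnerDivisor (OpHardy.tilde (OpHardy.row Δ Δc)) Ψ ∧
      (¬ OpHardy.IsConst Δ → ¬ OpHardy.IsUnitaryConst (OpHardy.tilde (OpHardy.row Δ Δc))) := by
  have hrow := hΔc.isTwoSidedInner_row hΔ.1.1 hbt
  exact ⟨OpHardy.isRightInnerDivisor_tilde_row hΦ hΔ.1 hrow,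
    OpHardy.isRightInnerDivisor_tilde_row hΨ hΔ.2.1 hrow,
    mt OpHardy.isConst_of_isUnitaryConst_tilde_row⟩
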